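/- Let $E$ be a real or complex normed vector space with a countable algebraic basis $(e_i)_{i\in\mathbb N}$, $\|e_i\|=1$. For $x=\sum_i a_ie_i\in E$ let $\operatorname{supp}(x)=\{i: a_i\neq 0\}$ (a finite set); for $k,n\in\mathbb N$ and non-zero $x,y\in E$ write $k<x$ if $k<\min\operatorname{supp}(x)$, $x<n$ if $\max\operatorname{supp}(x)<n$, and $x<y$ if $\max\operatorname{supp}(x)<\min\operatorname{supp}(y)$. A normalised block sequence is a finite or infinite sequence $(x_i)$ of norm-one vectors of $E$ with $x_i<x_{i+1}$ for all $i$; let $bb(e_i)\subseteq E^{\mathbb N}$ be the set of the infinite ones. Here $E$ carries the Borel structure of the norm topology (equivalently, of the increasing union of the finite-dimensional subspaces $[e_0,\dots,e_n]$), and analytic subsets of $E^{\mathbb N}$ are meant with respect to it. Write $\Delta>0$ if $\Delta=(\delta_i)_{i\in\mathbb N}$ is a decreasing sequence of strictly positive reals converging to $0$, and for $\mathcal A\subseteq bb(e_i)$ put $$\mathcal A_\Delta=\{(y_i)\in bb(e_i):\ \exists (x_i)\in\mathcal A\ \forall i\ \|x_i-y_i\|<\delta_i\}.$$ For a strictly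 increasing sequence $(m_i)$ of natural numbers and $(x_i)\in bb(e_i)$ let $$\mathcal R(m_i,x_i)\iff \forall i\ \exists j\quad m_0<x_i<m_j<m_{j+1}<x_{i+1}.$$ In the infinite asymptotic game (IAG), players I and II alternate, I beginning; I plays natural numbers $n_0,n_1,\dots$, and II answers each $n_i$ with a norm-one vector $x_i\in E$ such that $n_i<x_i$, and $x_{i-1}<x_i$ if $i\geq 1$. The outcome is $(x_i)$, and II has a strategy to play in a set $\mathcal S$ if II can answer I's moves, as a function of the moves made so far, so that the outcome always lies in $\mathcal S$. A block tree is a non-empty set $T$ of finite normalised block sequences, closed under initial segments, such that for every $s\in T$ (including $s=\emptyset$) there is $(y_j)_{j\in\mathbb N}\in bb(e_i)$ with $\{y\in E: s^\frown y\in T\}=\{y_j: j\in\mathbb N\}$ and, if $s\neq\emptyset$, with $y_0$ larger (in the sense of $<$) than the last term of $s$. Let $[T]$ be the set of $(x_i)\in bb(e_i)$ such that $(x_0,\dots,x_n)\in T$ for all $n$. **Theorem.** Let $\mathcal A\subseteq bb(e_i)$ be analytic. Then the following are equivalent: (a) for all $\Delta>0$ and all strictly increasing sequences $(m_i)$ of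 natural numbers there is $(x_i)\in\mathcal A_\Delta$ with $\mathcal R(m_i,x_i)$; (b) for all $\Delta>0$, II has a strategy in (IAG) to play in $\mathcal A_\Delta$; (c) for all $\Delta>0$ there is a block tree $T$ with $[T]\subseteq\mathcal A_\Delta$. -/

import Mathlib

/-! Normalised block sequences, the infinite asymptotic game, and block trees over an algebraic
basis `e` of a real or complex normed space `E`. -/

namespace AsymptoticGame

variable {𝕜 E : Type*} [RCLike 𝕜] [NormedAddCommGroup E] [NormedSpace 𝕜 E]

/-- The support of a vector with respect to the basis `e`. -/
noncomputable def supp (e : Module.Basis ℕ 𝕜 E) (x : E) : Finset ℕ := (e.repr x).support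

/-- `k < x`: the number `k` lies strictly below the support of `x`. -/
def NatLT (e : Module.Basis ℕ 𝕜 E) (k : ℕ) (x : E) : Prop := ∀ i ∈ supp e x, k < i

/-- `x < k`: the support of `x` lies strictly below the number `k`. -/
def LTNat (e : Module.Basis ℕ 𝕜 E) (x : E) (k : ℕ) : Prop := ∀ i ∈ supp e x, i < k

/-- `x < y`: the support of `x` lies strictly below the support of `y`. It is used for non-zero
vectors only. -/
def VecLT (e : Module.Basis ℕ 𝕜 E) (x y : E) : Prop := ∀ i ∈ supp e x, ∀ j ∈ supp e y, i < j

/-- The set `bb(e)` of infinite normalised block sequences. -/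
def bb (e : Module.Basis ℕ 𝕜 E) : Set (ℕ → E) :=
  {x | (∀ i, ‖x i‖ = 1) ∧ ∀ i, VecLT e (x i) (x (i + 1))}

/-- The set `fbb(e)` of finite normalised block sequences (the empty one included). -/
def fbb (e : Module.Basis ℕ 𝕜 E) : Set (List E) :=
  {s | (∀ x ∈ s, ‖x‖ = 1) ∧ s.IsChain (VecLT e)}

/-- `Δ > 0`: a decreasing sequence of strictly positive reals that converges to `0`. -/
def PosNull (δ : ℕ → ℝ) : Prop :=
  (∀ i, 0 < δ i) ∧ Antitone δ ∧ Filter.Tendsto δ Filter.atTop (nhds 0)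

/-- The `Δ`-expansion `A_Δ` of a set `A` of normalised block sequences. -/
def expansion (e : Module.Basis ℕ 𝕜 E) (A : Set (ℕ → E)) (δ : ℕ → ℝ) : Set (ℕ → E) :=
  {y | y ∈ bb e ∧ ∃ x ∈ A, ∀ i, ‖x i - y i‖ < δ i}

/-- The relation `R(m, x)`: for every `i` there is `j` with
`m 0 < x i < m j < m (j + 1) < x (i + 1)`. -/
def Separates (e : Module.Basis ℕ 𝕜 E) (m : ℕ → ℕ) (x : ℕ → E) : Prop :=
  ∀ i, ∃ j, NatLT e (m 0) (x i) ∧ LTNat e (x i) (m j) ∧ m j < m (j + 1) ∧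
    NatLT e (m (j + 1)) (x (i + 1))

/-- The sequence of vectors that II plays when following `σ` against the moves `n` of I:
the `k`-th vector is `σ (n 0, …, n k)`. -/
def outcome (σ : List ℕ → E) (n : ℕ → ℕ) (k : ℕ) : E := σ ((List.range (k + 1)).map n)

/-- II has a strategy in the infinite asymptotic game to play in `S`. A strategy answers each
finite non-empty sequence of moves of I. Against every sequence `n` of moves of I all its answers
have to be legal (normalised, `n k < x k` and `x k < x (k + 1)`), and the outcome has to lie in
`S`. -/
def IIHasStrategy (e : Module.Basis ℕ 𝕜 E) (S : Set (ℕ → E)) : Prop :=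
  ∃ σ : List ℕ → E, ∀ n : ℕ → ℕ,
    (∀ k, ‖outcome σ n k‖ = 1 ∧ NatLT e (n k) (outcome σ n k) ∧
      VecLT e (outcome σ n k) (outcome σ n (k + 1))) ∧
    outcome σ n ∈ S

/-- `T` is a block tree: a non-empty set of finite normalised block sequences, closed under initial
segments, such that for every `s ∈ T` (the empty sequence included) the set of `y` with
`s ⌢ y ∈ T` is the range of some infinite normalised block sequence `(y j)` whose first term
lies after the last term of `s` (if there is one). -/
structure IsBlockTree (e : Module.Basis ℕ 𝕜 E) (T : Set (List E)) : Prop where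
  nonempty : T.Nonempty
  subset_fbb : T ⊆ fbb e
  prefix_mem : ∀ s ∈ T, ∀ t : List E, t <+: s → t ∈ T
  successors : ∀ s ∈ T, ∃ y ∈ bb e,
    {z : E | s ++ [z] ∈ T} = Set.range y ∧ ∀ x ∈ s.getLast?, VecLT e x (y 0)

/-- The set `[T]` of infinite branches of `T`. -/
def branches (e : Module.Basis ℕ 𝕜 E) (T : Set (List E)) : Set (ℕ → E) :=
  {x | x ∈ bb e ∧ ∀ n, (List.range (n + 1)).map x ∈ T}

end AsymptoticGame

/-! The substance is the step from (a) to (b). Write `A` as the range of a continuous `f` on Baire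
space and unfold the game: besides vectors from finite nets, II gradually reveals a witness `α` for
which `f α` stays close to the play. If the initial position is not `Lost`, II always has a
well-founded plan that reaches the next entry of the witness (`nonempty_attack_of_not_lost`).
Following such plans forever produces all of `α` (`exists_strategy_of_plan`), and continuity of `f`
puts the outcome in the expansion. If it is `Lost`, a single gap function `g` defeats every play
together with every witness (`Lost.exists_bound`): only finitely many net positions lie below a
given bound, and an entry `k` is used only from an index at least `k` on, so `g` meets finitely many
demands at a time. A sequence `m` outgrowing `g` then contradicts (a). For (b) to (c), probing a
strategy with moves that spread out its answers yields a block tree. For (c) to (a), one descends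
the tree, taking successors far enough out. -/

namespace AsymptoticGame

/-! ### The unfolded game: lost positions and plans. -/

section Unfolded

variable {X : Type*}

/-- The positions `(x, s)` lost for II in the unfolded game: II plays terms of `x` and, from time
to time, extends the witness `s` by one number. Either the position is dead, or I can keep the
play in a set `C` such that II loses as soon as the witness is extended. -/
inductive Lost (lo : X → ℕ) (D : ℕ → Set X) (Alive : List X → List ℕ → Prop) :
    List X → List ℕ → Prop
  | dead {x : List X} {s : List ℕ} (h : ¬ Alive x s) : Lost lo D Alive x s
  | hold {x : List X} {s : List ℕ} (C : Set (List X)) (n : List X → ℕ) (hx : x ∈ C)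
      (hC : ∀ u ∈ C, ∀ y ∈ D u.length, n u < lo y → u ++ [y] ∈ C)
      (hL : ∀ u ∈ C, ∀ y ∈ D u.length, n u < lo y → ∀ k, Lost lo D Alive (u ++ [y]) (s ++ [k])) :
      Lost lo D Alive x s

/-- A well-founded plan of II that leads from `x` to an extension of the witness `s` for which the
new position lies in `Z`. -/
inductive Attack (lo : X → ℕ) (D : ℕ → Set X) (Z : List X → List ℕ → Prop) (s : List ℕ) :
    List X → Type _
  | mk {x : List X} (f : ℕ → X) (c : ℕ → Option ℕ) (hf : ∀ n, f n ∈ D x.length ∧ n < lo (f n))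
      (hZ : ∀ n k, c n = some k → Z (x ++ [f n]) (s ++ [k]))
      (next : ∀ n, c n = none → Attack lo D Z s (x ++ [f n])) : Attack lo D Z s x

variable {lo hi : X → ℕ} {D : ℕ → Set X} {Alive Z : List X → List ℕ → Prop}

theorem alive_of_not_lost {x : List X} {s : List ℕ} (h : ¬ Lost lo D Alive x s) : Alive x s := by
  by_contra h'
  exact h (.dead h')

theorem nonempty_attack_of_not_lost {x : List X} {s : List ℕ} (h : ¬ Lost lo D Alive x s) :
    Nonempty (Attack lo D (fun u t => ¬ Lost lo D Alive u t) s x) := by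
  by_contra hx
  have key : ∀ u, ¬ Nonempty (Attack lo D (fun u t => ¬ Lost lo D Alive u t) s u) →
      ∃ n, ∀ y ∈ D u.length, n < lo y →
        (¬ Nonempty (Attack lo D (fun u t => ¬ Lost lo D Alive u t) s (u ++ [y]))) ∧
        ∀ k, Lost lo D Alive (u ++ [y]) (s ++ [k]) := by
    intro u hu
    -- Otherwise II has a good answer to every `n`, and these answers assemble into an attack from
    -- `u`.
    by_contra! hn
    refine hu ?_
    have hn' : ∀ n, ∃ y, ∃ c : Option ℕ, (y ∈ D u.length ∧ n < lo y) ∧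
        (∀ k, c = some k → ¬ Lost lo D Alive (u ++ [y]) (s ++ [k])) ∧
        (c = none → Nonempty (Attack lo D (fun u t => ¬ Lost lo D Alive u t) s (u ++ [y]))) := by
      intro n
      obtain ⟨y, hy, hny, h⟩ := hn n
      by_cases hA : Nonempty (Attack lo D (fun u t => ¬ Lost lo D Alive u t) s (u ++ [y]))
      · exact ⟨y, none, ⟨hy, hny⟩, by simp, fun _ => hA⟩
      · obtain ⟨k, hk⟩ := h (not_nonempty_iff.1 hA)
        refine ⟨y, some k, ⟨hy, hny⟩, ?_, by simp⟩
        intro k' hk'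
        cases hk'
        exact hk
    choose f c hf hZ next using hn'
    exact ⟨.mk f c hf hZ fun n hn => (next n hn).some⟩
  choose! n hn using key
  -- The positions without an attack themselves form a set in which I can hold the play.
  exact h (.hold {u | ¬ Nonempty (Attack lo D (fun u t => ¬ Lost lo D Alive u t) s u)} n hx
    (fun u hu y hy hny => (hn u hu y hy hny).1) (fun u hu y hy hny => (hn u hu y hy hny).2))

/-! ### Lost positions are beaten by fast growth. -/

/-- The bound that the terms before the index `i` put on the term with index `i`. -/
def prevHi (hi : X → ℕ) (u : ℕ → X) : ℕ → ℕ
  | 0 => 0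
  | i + 1 => hi (u i)

theorem map_range_succ {Y : Type*} (u : ℕ → Y) (i : ℕ) :
    (List.range (i + 1)).map u = (List.range i).map u ++ [u i] := by
  simp [List.range_succ]

/-- The sequences of length `l` of elements of `D` that are bounded by `N`. -/
def boundedLists (hi : X → ℕ) (D : ℕ → Set X) (N : ℕ) : ℕ → Set (List X)
  | 0 => {[]}
  | l + 1 => Set.image2 (fun v y => v ++ [y]) (boundedLists hi D N l) {y ∈ D l | hi y ≤ N}

theorem finite_boundedLists (hfin : ∀ i N, {y ∈ D i | hi y ≤ N}.Finite) (N l : ℕ) :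
    (boundedLists hi D N l).Finite := by
  induction l with
  | zero => exact Set.finite_singleton _
  | succ l ih => exact ih.image2 _ (hfin l N)

theorem map_range_mem_boundedLists {u : ℕ → X} (hu : ∀ i, u i ∈ D i) {N l : ℕ}
    (h : ∀ i < l, hi (u i) ≤ N) : (List.range l).map u ∈ boundedLists hi D N l := by
  induction l with
  | zero => simp [boundedLists]
  | succ l ih =>
    rw [map_range_succ]
    exact ⟨_, ih fun i hl => h i (by omega), _, ⟨hu l, h l (by omega)⟩, rfl⟩

theorem exists_bound_boundedLists (hfin : ∀ i N, {y ∈ D i | hi y ≤ N}.Finite) (n : List X → ℕ)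
    (G : List X → ℕ → ℕ → ℕ) : ∃ g : ℕ → ℕ, ∀ N, ∀ l ≤ N, ∀ v ∈ boundedLists hi D N l,
      n v ≤ g N ∧ ∀ k ≤ N, G v k N ≤ g N := by
  have h : ∀ N, ∃ b, ∀ l ≤ N, ∀ v ∈ boundedLists hi D N l,
      n v ≤ b ∧ ∀ k ≤ N, G v k N ≤ b := by
    intro N
    have hF : (⋃ l ∈ Set.Iic N, boundedLists hi D N l).Finite :=
      (Set.finite_Iic N).biUnion fun l _ => finite_boundedLists hfin N l
    refine ⟨hF.toFinset.sup fun v => n v + ∑ k ∈ Finset.range (N + 1), G v k N, ?_⟩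
    intro l hl v hv
    have hv' : v ∈ hF.toFinset := by
      rw [Set.Finite.mem_toFinset]
      exact Set.mem_biUnion (show l ∈ Set.Iic N from hl) hv
    have hle := Finset.le_sup (f := fun v => n v + ∑ k ∈ Finset.range (N + 1), G v k N) hv'
    refine ⟨le_trans (Nat.le_add_right _ _) hle, fun k hk => le_trans ?_ hle⟩
    have : G v k N ≤ ∑ k ∈ Finset.range (N + 1), G v k N :=
      Finset.single_le_sum (f := fun k => G v k N) (fun _ _ => Nat.zero_le _)
        (Finset.mem_range.2 (by omega))
    exact this.trans (Nat.le_add_left _ _)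
  choose g hg using h
  exact ⟨g, hg⟩

theorem hi_mono (hD : ∀ i, ∀ y ∈ D i, lo y < hi y) {u : ℕ → X} (hu : ∀ i, u i ∈ D i)
    (hb : ∀ i, hi (u i) < lo (u (i + 1))) : StrictMono fun i => hi (u i) :=
  strictMono_nat_of_lt_succ fun i => (hb i).trans (hD _ _ (hu _))

/-- The bound must not depend on `α`, which I never sees. A single entry has infinitely many
possible values, but its use can be postponed: as long as the gaps obey `n`, the play remains in
`C`, where every extension of the witness is lost. -/
theorem Lost.exists_bound (hD : ∀ i, ∀ y ∈ D i, lo y < hi y)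
    (hfin : ∀ i N, {y ∈ D i | hi y ≤ N}.Finite) {x : List X} {s : List ℕ}
    (h : Lost lo D Alive x s) :
    ∃ g : ℕ → ℕ, ∀ (u : ℕ → X) (α : ℕ → ℕ), (∀ i, u i ∈ D i) →
      (∀ i, hi (u i) < lo (u (i + 1))) → (List.range x.length).map u = x →
      (List.range s.length).map α = s → (∀ i, x.length ≤ i → g (prevHi hi u i) < lo (u i)) →
      ∃ i j, ¬ Alive ((List.range i).map u) ((List.range j).map α) := by
  induction h with
  | @dead x s h =>
    exact ⟨fun _ => 0, fun u α _ _ hx hs _ => ⟨x.length, s.length, by rwa [hx, hs]⟩⟩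
  | @hold x s C n hx hC _ ih =>
    -- The guard makes `G` total, so that one function can dominate it over all bounded lists.
    have hG : ∀ (v : List X) (k : ℕ), ∃ g : ℕ → ℕ,
        (∃ u ∈ C, ∃ y ∈ D u.length, n u < lo y ∧ v = u ++ [y]) →
        ∀ (u : ℕ → X) (α : ℕ → ℕ), (∀ i, u i ∈ D i) →
        (∀ i, hi (u i) < lo (u (i + 1))) → (List.range v.length).map u = v →
        (List.range (s ++ [k]).length).map α = s ++ [k] →
        (∀ i, v.length ≤ i → g (prevHi hi u i) < lo (u i)) →
        ∃ i j, ¬ Alive ((List.range i).map u) ((List.range j).map α) := by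
      intro v k
      by_cases hv : ∃ u ∈ C, ∃ y ∈ D u.length, n u < lo y ∧ v = u ++ [y]
      · obtain ⟨u, hu, y, hy, hn, rfl⟩ := hv
        obtain ⟨g, hg⟩ := ih u hu y hy hn k
        exact ⟨g, fun _ => hg⟩
      · exact ⟨0, fun h => absurd h hv⟩
    choose G hG using hG
    obtain ⟨g, hg⟩ := exists_bound_boundedLists hfin n G
    refine ⟨g, fun u α hu hb hxu hsα hgu => ?_⟩
    have hmono := hi_mono hD hu hb
    have hle : ∀ i, i ≤ prevHi hi u i := by
      intro i
      induction i with
      | zero => exact Nat.zero_le _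
      | succ i ih =>
        refine Nat.succ_le_of_lt (ih.trans_lt ?_)
        cases i with
        | zero => exact (Nat.zero_le _).trans_lt (hD _ _ (hu 0))
        | succ i => exact hmono i.lt_succ_self
    have hmem : ∀ l i, l ≤ i → (List.range l).map u ∈ boundedLists hi D (prevHi hi u i) l := by
      intro l i hl
      refine map_range_mem_boundedLists hu fun j hj => ?_
      obtain ⟨i, rfl⟩ : ∃ i', i = i' + 1 := ⟨i - 1, by omega⟩
      exact hmono.monotone (by omega)
    have hmemC : ∀ i, x.length ≤ i → (List.range i).map u ∈ C := by
      intro i hi'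
      induction i, hi' using Nat.le_induction with
      | base => rwa [hxu]
      | succ i hi' ihC =>
        rw [map_range_succ]
        refine hC _ ihC _ (by simpa using hu i) ?_
        exact lt_of_le_of_lt (hg _ i (hle i) _ (hmem i i le_rfl)).1 (hgu i hi')
    set k := α s.length with hk
    -- From this index on the bound `prevHi hi u i` is at least `k`, so `g` already dominates the
    -- demand for the entry `k`.
    set i₀ := max x.length k with hi₀
    have hxi : x.length ≤ i₀ := le_max_left _ _
    have hki : k ≤ i₀ := le_max_right _ _
    refine hG ((List.range (i₀ + 1)).map u) k
      ⟨_, hmemC i₀ hxi, u i₀, by simpa using hu i₀, ?_, map_range_succ u i₀⟩ u α hu hb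
      (by simp) ?_ ?_
    · exact lt_of_le_of_lt (hg _ i₀ (hle i₀) _ (hmem i₀ i₀ le_rfl)).1 (hgu i₀ hxi)
    · rw [List.length_append, List.length_singleton, map_range_succ, hsα]
    · intro i hi'
      rw [List.length_map, List.length_range] at hi'
      refine lt_of_le_of_lt ((hg (prevHi hi u i) (i₀ + 1) (hi'.trans (hle i)) _
        (hmem _ _ hi')).2 k ?_) (hgu i (by omega))
      exact (hki.trans (by omega)).trans (hle i)

/-! ### A strategy from plans. -/

/-- A position of the unfolded game with a plan of II. -/
structure State (lo : X → ℕ) (D : ℕ → Set X) (Z : List X → List ℕ → Prop) where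
  fst : List X
  wit : List ℕ
  plan : Attack lo D Z wit fst

/-- II answers the move `n` of I according to the plan, beyond all terms played before. -/
noncomputable def State.step (hi : X → ℕ) (hA : ∀ x s, Z x s → Nonempty (Attack lo D Z s x)) :
    State lo D Z → ℕ → State lo D Z
  | ⟨x, s, .mk f c _ hZ next⟩, n =>
    match h : c (max n (x.map hi).sum) with
    | some k => ⟨x ++ [f (max n (x.map hi).sum)], s ++ [k], (hA _ _ (hZ _ k h)).some⟩
    | none => ⟨x ++ [f (max n (x.map hi).sum)], s, next _ h⟩

theorem State.step_fst (hA : ∀ x s, Z x s → Nonempty (Attack lo D Z s x)) (p : State lo D Z)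
    (n : ℕ) : ∃ y ∈ D p.fst.length, n < lo y ∧ (p.fst.map hi).sum < lo y ∧
      (p.step hi hA n).fst = p.fst ++ [y] := by
  obtain ⟨x, s, ⟨f, c, hf, hZ, next⟩⟩ := p
  refine ⟨f (max n (x.map hi).sum), (hf _).1, (le_max_left _ _).trans_lt (hf _).2,
    (le_max_right _ _).trans_lt (hf _).2, ?_⟩
  simp only [State.step]
  split <;> rfl

/-- A plan is well-founded, so II cannot postpone the next entry forever. -/
theorem State.exists_extension (hA : ∀ x s, Z x s → Nonempty (Attack lo D Z s x)) (n : ℕ → ℕ)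
    (P : ℕ → State lo D Z) (hP : ∀ i, P (i + 1) = (P i).step hi hA (n i)) {s : List ℕ}
    {x : List X} (a : Attack lo D Z s x) (i : ℕ) (hi' : P i = ⟨x, s, a⟩) :
    ∃ j > i, ∃ k, (P j).wit = s ++ [k] ∧ Z (P j).fst (P j).wit := by
  induction a generalizing i with
  | @mk x f c hf hZ next ih =>
    have h := hP i
    rw [hi'] at h
    simp only [State.step] at h
    split at h
    next k hk => exact ⟨i + 1, by omega, k, by rw [h], by rw [h]; exact hZ _ _ hk⟩
    next hk =>
      obtain ⟨j, hj, h'⟩ := ih _ hk (i + 1) h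
      exact ⟨j, by omega, h'⟩

theorem exists_strategy_of_plan [Nonempty X] (hZA : ∀ x s, Z x s → Alive x s)
    (hA : ∀ x s, Z x s → Nonempty (Attack lo D Z s x)) (h0 : Z [] []) :
    ∃ σ : List ℕ → X, ∀ n : ℕ → ℕ, ∃ u : ℕ → X, (∀ k, u k = σ ((List.range (k + 1)).map n)) ∧
      (∀ k, u k ∈ D k ∧ n k < lo (u k) ∧ hi (u k) < lo (u (k + 1))) ∧
      ∃ α : ℕ → ℕ, ∀ j, ∃ i ≥ j, Alive ((List.range i).map u) ((List.range j).map α) := by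
  let st : List ℕ → State lo D Z := List.foldl (State.step hi hA) ⟨[], [], (hA _ _ h0).some⟩
  refine ⟨fun l => (st l).fst.getLastD (Classical.arbitrary X), fun n => ?_⟩
  let P : ℕ → State lo D Z := fun i => st ((List.range i).map n)
  have hP : ∀ i, P (i + 1) = (P i).step hi hA (n i) := by
    intro i
    simp only [P, st, map_range_succ, List.foldl_append, List.foldl_cons, List.foldl_nil]
  have hstep : ∀ i, ∃ y ∈ D (P i).fst.length, n i < lo y ∧ ((P i).fst.map hi).sum < lo y ∧
      (P (i + 1)).fst = (P i).fst ++ [y] := fun i => by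
    rw [hP i]
    exact State.step_fst hA (P i) (n i)
  choose u huD hun hub huP using hstep
  have hfst : ∀ i, (P i).fst = (List.range i).map u := by
    intro i
    induction i with
    | zero => rfl
    | succ i ih => rw [huP, ih, map_range_succ]
  refine ⟨u, fun k => ?_, fun k => ⟨by simpa [hfst] using huD k, hun k, ?_⟩, ?_⟩
  · change u k = (P (k + 1)).fst.getLastD _
    rw [huP]
    simp
  · refine lt_of_le_of_lt ?_ (hub (k + 1))
    rw [huP]
    simp
  · have hext : ∀ i : {i // Z (P i).fst (P i).wit}, ∃ j : {i // Z (P i).fst (P i).wit}, ∃ k,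
        i.1 < j.1 ∧ (P j.1).wit = (P i.1).wit ++ [k] := by
      rintro ⟨i, hi'⟩
      obtain ⟨j, hj, k, hw, hz⟩ := State.exists_extension hA n P hP (P i).plan i rfl
      exact ⟨⟨j, hz⟩, k, hj, hw⟩
    choose g κ hg hκ using hext
    -- `I j` is a stage at which the witness has exactly `j` entries.
    let I : ℕ → {i // Z (P i).fst (P i).wit} := fun j => g^[j] ⟨0, h0⟩
    have hI : ∀ j, I (j + 1) = g (I j) := fun j => Function.iterate_succ_apply' _ _ _
    have hwit : ∀ j, (P (I j).1).wit = (List.range j).map fun j => κ (I j) := by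
      intro j
      induction j with
      | zero => rfl
      | succ j ih => rw [hI, hκ, ih, map_range_succ]
    have hle : ∀ j, j ≤ (I j).1 := by
      intro j
      induction j with
      | zero => exact Nat.zero_le _
      | succ j ih =>
        have := hg (I j)
        rw [hI]
        omega
    refine ⟨fun j => κ (I j), fun j => ⟨(I j).1, hle j, ?_⟩⟩
    rw [← hwit, ← hfst]
    exact hZA _ _ (I j).2

theorem exists_strategy_of_forall_strictMono [Nonempty X] (hD : ∀ i, ∀ y ∈ D i, lo y < hi y)
    (hfin : ∀ i N, {y ∈ D i | hi y ≤ N}.Finite)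
    (h : ∀ m : ℕ → ℕ, StrictMono m → ∃ (u : ℕ → X) (α : ℕ → ℕ), (∀ i, u i ∈ D i) ∧
      (∀ i, ∃ j, m 0 < lo (u i) ∧ hi (u i) ≤ m j ∧ m (j + 1) < lo (u (i + 1))) ∧
      ∀ i j, Alive ((List.range i).map u) ((List.range j).map α)) :
    ∃ σ : List ℕ → X, ∀ n : ℕ → ℕ, ∃ u : ℕ → X, (∀ k, u k = σ ((List.range (k + 1)).map n)) ∧
      (∀ k, u k ∈ D k ∧ n k < lo (u k) ∧ hi (u k) < lo (u (k + 1))) ∧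
      ∃ α : ℕ → ℕ, ∀ j, ∃ i ≥ j, Alive ((List.range i).map u) ((List.range j).map α) := by
  refine exists_strategy_of_plan (Z := fun x s => ¬ Lost lo D Alive x s)
    (fun _ _ => alive_of_not_lost) (fun _ _ => nonempty_attack_of_not_lost) fun hL => ?_
  obtain ⟨g, hg⟩ := hL.exists_bound hD hfin
  -- A monotone majorant of `g`: the hypothesis bounds `hi (u i)` by some `m j` but does not
  -- determine it.
  let g' : ℕ → ℕ := fun N => ∑ a ∈ Finset.range (N + 1), g a
  have hgg' : ∀ a N, a ≤ N → g a ≤ g' N := fun a N haN =>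
    Finset.single_le_sum (f := g) (fun _ _ => Nat.zero_le _) (Finset.mem_range.2 (by omega))
  let m : ℕ → ℕ := Nat.rec (g' 0) fun _ a => a + 1 + g' a
  have hm : ∀ j, m (j + 1) = m j + 1 + g' (m j) := fun _ => rfl
  have hmono : StrictMono m := strictMono_nat_of_lt_succ fun j => by
    rw [hm]
    omega
  obtain ⟨u, α, huD, hR, hal⟩ := h m hmono
  have hblock : ∀ i, hi (u i) < lo (u (i + 1)) := fun i => by
    obtain ⟨j, _, h1, h2⟩ := hR i
    exact h1.trans_lt ((hmono j.lt_succ_self).trans h2)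
  have hbound : ∀ i, g (prevHi hi u i) < lo (u i) := fun i => by
    cases i with
    | zero =>
      obtain ⟨j, h0, _⟩ := hR 0
      exact (hgg' 0 0 le_rfl).trans_lt h0
    | succ i =>
      obtain ⟨j, _, h1, h2⟩ := hR i
      have h3 : g (hi (u i)) ≤ g' (m j) := hgg' _ _ h1
      change g (hi (u i)) < _
      have := hm j
      omega
  obtain ⟨i, j, hij⟩ := hg u α huD hblock rfl rfl fun i _ => hbound i
  exact hij (hal i j)

end Unfolded

/-! ### Supports, block sequences and finite nets. -/

variable {𝕜 E : Type*} [RCLike 𝕜] [NormedAddCommGroup E] [NormedSpace 𝕜 E]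

/-- The minimum of the support. -/
noncomputable def lo (e : Module.Basis ℕ 𝕜 E) (x : E) : ℕ := sInf (supp e x : Set ℕ)

/-- The least number above the support. -/
noncomputable def hi (e : Module.Basis ℕ 𝕜 E) (x : E) : ℕ := (supp e x).sup (· + 1)

variable {e : Module.Basis ℕ 𝕜 E} {x y : E} {k : ℕ}

theorem supp_nonempty (hx : ‖x‖ = 1) : (supp e x).Nonempty := by
  rw [supp, Finsupp.support_nonempty_iff]
  intro h
  rw [LinearEquiv.map_eq_zero_iff] at h
  simp [h] at hx

theorem lo_mem (hx : ‖x‖ = 1) : lo e x ∈ supp e x :=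
  Finset.mem_coe.1 (Nat.sInf_mem (Finset.coe_nonempty.2 (supp_nonempty hx)))

theorem natLT_iff (hx : ‖x‖ = 1) : NatLT e k x ↔ k < lo e x :=
  ⟨fun h => h _ (lo_mem hx), fun h _ hi => h.trans_le (Nat.sInf_le (Finset.mem_coe.2 hi))⟩

theorem ltNat_iff : LTNat e x k ↔ hi e x ≤ k := by
  simp [LTNat, hi]

theorem lt_hi {i : ℕ} (h : i ∈ supp e x) : i < hi e x := ltNat_iff.2 le_rfl i h

theorem lo_lt_hi (hx : ‖x‖ = 1) : lo e x < hi e x := lt_hi (lo_mem hx)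

theorem VecLT.of_hi_lt (hy : ‖y‖ = 1) (h : hi e x < lo e y) : VecLT e x y :=
  fun _ hi' _ hj => (lt_hi hi').trans ((natLT_iff hy).2 h _ hj)

theorem VecLT.of_natLT (h : NatLT e (hi e x) y) : VecLT e x y :=
  fun _ hi' _ hj => (lt_hi hi').trans (h _ hj)

theorem VecLT.irrefl (hx : ‖x‖ = 1) : ¬ VecLT e x x :=
  fun h => lt_irrefl _ (h _ (lo_mem hx) _ (lo_mem hx))

theorem VecLT.trans {z : E} (hy : ‖y‖ = 1) (h : VecLT e x y) (h' : VecLT e y z) : VecLT e x z :=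
  fun _ hi' _ hj => (h _ hi' _ (lo_mem hy)).trans (h' _ (lo_mem hy) _ hj)

theorem vecLT_of_mem_bb {x : ℕ → E} (hx : x ∈ bb e) {i j : ℕ} (h : i < j) :
    VecLT e (x i) (x j) := by
  induction j, h using Nat.le_induction with
  | base => exact hx.2 i
  | succ j _ ih => exact ih.trans (hx.1 j) (hx.2 j)

theorem injective_of_mem_bb {x : ℕ → E} (hx : x ∈ bb e) : Function.Injective x := by
  intro i j h
  by_contra hne
  rcases lt_or_gt_of_ne hne with hlt | hlt
  · exact VecLT.irrefl (hx.1 j) (h ▸ vecLT_of_mem_bb hx hlt)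
  · exact VecLT.irrefl (hx.1 i) (h.symm ▸ vecLT_of_mem_bb hx hlt)

theorem natLT_of_mem_bb {x : ℕ → E} (hx : x ∈ bb e) (k : ℕ) : NatLT e k (x (k + 1)) := by
  induction k with
  | zero => exact fun j hj => (Nat.zero_le _).trans_lt (hx.2 0 _ (lo_mem (hx.1 0)) j hj)
  | succ k ih => exact fun j hj =>
      (Nat.succ_le_of_lt (ih _ (lo_mem (hx.1 _)))).trans_lt (hx.2 (k + 1) _ (lo_mem (hx.1 _)) j hj)

/-- These vectors lie in the unit ball of a finite-dimensional span, which is compact. -/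
theorem totallyBounded_sphere_supp (e : Module.Basis ℕ 𝕜 E) (F : Finset ℕ) :
    TotallyBounded {x : E | ‖x‖ = 1 ∧ supp e x = F} := by
  let V : Submodule 𝕜 E := Submodule.span 𝕜 (e '' F)
  have : FiniteDimensional 𝕜 V := FiniteDimensional.span_of_finite 𝕜 (F.finite_toSet.image e)
  have : ProperSpace V := FiniteDimensional.proper_rclike 𝕜 V
  have hc : IsCompact (Subtype.val '' Metric.closedBall (0 : V) 1) :=
    (isCompact_closedBall _ _).image continuous_subtype_val
  refine hc.totallyBounded.subset ?_
  rintro x ⟨hx, rfl⟩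
  have hxV : x ∈ V := e.mem_span_repr_support x
  exact ⟨⟨x, hxV⟩, by simp [hx], rfl⟩

/-- Finite nets in the spheres of vectors with a given support, put together. -/
theorem exists_net (e : Module.Basis ℕ 𝕜 E) {ε : ℝ} (hε : 0 < ε) :
    ∃ D : Set E, (∀ y ∈ D, ‖y‖ = 1) ∧ (∀ N, {y ∈ D | hi e y ≤ N}.Finite) ∧
      ∀ x, ‖x‖ = 1 → ∃ y ∈ D, supp e y = supp e x ∧ ‖x - y‖ < ε := by
  have h : ∀ F : Finset ℕ, ∃ t ⊆ {x : E | ‖x‖ = 1 ∧ supp e x = F}, t.Finite ∧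
      {x : E | ‖x‖ = 1 ∧ supp e x = F} ⊆ ⋃ y ∈ t, Metric.ball y ε :=
    fun F => Metric.finite_approx_of_totallyBounded (totallyBounded_sphere_supp e F) ε hε
  choose t ht hfin hcov using h
  refine ⟨⋃ F, t F, ?_, fun N => ?_, fun x hx => ?_⟩
  · intro y hy
    obtain ⟨F, hF⟩ := Set.mem_iUnion.1 hy
    exact (ht F hF).1
  · refine ((Finset.range N).powerset.finite_toSet.biUnion fun F _ => hfin F).subset ?_
    rintro y ⟨hy, hN⟩
    obtain ⟨F, hF⟩ := Set.mem_iUnion.1 hy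
    refine Set.mem_biUnion ?_ hF
    rw [Finset.mem_coe, Finset.mem_powerset, ← (ht F hF).2]
    exact fun i hi' => Finset.mem_range.2 ((lt_hi hi').trans_le hN)
  · obtain ⟨y, hy, hxy⟩ := Set.mem_iUnion₂.1 (hcov (supp e x) ⟨hx, rfl⟩)
    exact ⟨y, Set.mem_iUnion.2 ⟨_, hy⟩, (ht _ hy).2, by rwa [← dist_eq_norm]⟩

/-! ### From (a) to (b). -/

theorem tendsto_of_eq_below {β : ℕ → ℕ → ℕ} {α : ℕ → ℕ} (h : ∀ j, ∀ l < j, β j l = α l) :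
    Filter.Tendsto β Filter.atTop (nhds α) := by
  rw [tendsto_pi_nhds]
  intro l
  refine tendsto_const_nhds.congr' ?_
  filter_upwards [Filter.eventually_gt_atTop l] with j hj using (h j l hj).symm

theorem iiHasStrategy_of_forall_separates {A : Set (ℕ → E)} (hA : MeasureTheory.AnalyticSet A)
    (h : ∀ δ : ℕ → ℝ, PosNull δ → ∀ m : ℕ → ℕ, StrictMono m →
      ∃ x : ℕ → E, Separates e m x ∧ x ∈ expansion e A δ) {δ : ℕ → ℝ} (hδ : PosNull δ) :
    IIHasStrategy e (expansion e A δ) := by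
  -- One quarter goes to the approximation in (a) and one to the net. The remaining half keeps the
  -- inequality strict in the limit.
  have hδ' : PosNull fun i => δ i / 4 := by
    refine ⟨fun i => div_pos (hδ.1 i) (by norm_num), fun i j hij => ?_, ?_⟩
    · exact div_le_div_of_nonneg_right (hδ.2.1 hij) (by norm_num)
    · simpa using hδ.2.2.div_const 4
  rw [MeasureTheory.AnalyticSet] at hA
  rcases hA with rfl | ⟨f, hf, rfl⟩
  · obtain ⟨x, _, _, y, hy, _⟩ := h _ hδ' id strictMono_id
    exact hy.elim
  choose D hDn hDfin hDx using fun i => exists_net e (hδ'.1 i)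
  let Alive : List E → List ℕ → Prop := fun x s => ∃ β : ℕ → ℕ,
    (∀ l k, s[l]? = some k → β l = k) ∧ ∀ l y, x[l]? = some y → ‖f β l - y‖ < δ l / 2
  obtain ⟨σ, hσ⟩ := exists_strategy_of_forall_strictMono (lo := lo e) (hi := hi e) (D := D)
    (Alive := Alive) (fun i y hy => lo_lt_hi (hDn i y hy)) hDfin fun m hm => by
      obtain ⟨x, hxm, ⟨hxbb, _, ⟨β, rfl⟩, hβ⟩⟩ := h _ hδ' m hm
      -- The net points keep the supports of the `x i`, so the separation carries over unchanged.
      choose u huD hus hux using fun i => hDx i (x i) (hxbb.1 i)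
      have hun : ∀ i, ‖u i‖ = 1 := fun i => hDn i _ (huD i)
      refine ⟨u, β, huD, fun i => ?_, fun i j => ⟨β, ?_, ?_⟩⟩
      · obtain ⟨j, h1, h2, _, h4⟩ := hxm i
        refine ⟨j, (natLT_iff (hun i)).1 ?_, ltNat_iff.1 ?_, (natLT_iff (hun _)).1 ?_⟩
        · simpa only [NatLT, hus] using h1
        · simpa only [LTNat, hus] using h2
        · simpa only [NatLT, hus] using h4
      · intro l k hk
        simp only [List.getElem?_map, Option.map_eq_some_iff, List.getElem?_eq_some_iff] at hk
        obtain ⟨_, ⟨_, rfl⟩, rfl⟩ := hk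
        simp
      · intro l y hy
        simp only [List.getElem?_map, Option.map_eq_some_iff, List.getElem?_eq_some_iff] at hy
        obtain ⟨_, ⟨_, rfl⟩, rfl⟩ := hy
        rw [List.getElem_range]
        calc ‖f β l - u l‖ ≤ ‖f β l - x l‖ + ‖x l - u l‖ := norm_sub_le_norm_sub_add_norm_sub _ _ _
          _ < δ l / 4 + δ l / 4 := add_lt_add (hβ l) (hux l)
          _ = δ l / 2 := by ring
  refine ⟨σ, fun n => ?_⟩
  obtain ⟨u, hu, hul, α, hα⟩ := hσ n
  obtain rfl : u = outcome σ n := funext hu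
  have hun : ∀ k, ‖outcome σ n k‖ = 1 := fun k => hDn k _ (hul k).1
  have hlt : ∀ k, VecLT e (outcome σ n k) (outcome σ n (k + 1)) :=
    fun k => VecLT.of_hi_lt (hun _) (hul k).2.2
  refine ⟨fun k => ⟨hun k, (natLT_iff (hun k)).2 (hul k).2.1, hlt k⟩, ⟨hun, hlt⟩,
    f α, ⟨α, rfl⟩, fun l => ?_⟩
  -- Each stage has its own `β j`. Agreement with `α` below `j` forces convergence to `α`, and
  -- continuity passes the estimates to `f α`.
  choose i hij β hβα hβu using hα
  have hβ : Filter.Tendsto β Filter.atTop (nhds α) :=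
    tendsto_of_eq_below fun j l hl => hβα j l (α l) (by simp [hl])
  have hlim : Filter.Tendsto (fun j => ‖f (β j) l - outcome σ n l‖) Filter.atTop
      (nhds ‖f α l - outcome σ n l‖) :=
    (((tendsto_pi_nhds.1 ((hf.tendsto α).comp hβ) l).sub_const _).norm)
  refine lt_of_le_of_lt (le_of_tendsto hlim ?_) (half_lt_self (hδ.1 l))
  filter_upwards [Filter.eventually_gt_atTop l] with j hj
  exact (hβu j l _ (by simp [hj.trans_le (hij j)])).le

/-! ### From (b) to (c). -/

theorem map_range_getD (l t : List ℕ) :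
    (List.range l.length).map (fun i => (l ++ t).getD i 0) = l := by
  refine List.ext_getElem (by simp) fun i h1 h2 => ?_
  simp [List.getElem?_append_left h2, List.getElem?_eq_getElem h2]

/-- `IIHasStrategy` speaks only of infinite runs; padding with zeros makes it apply to finite
positions. -/
theorem outcome_getD {F : Type*} (σ : List ℕ → F) (l t : List ℕ) (a : ℕ) :
    outcome σ (fun i => (l ++ [a] ++ t).getD i 0) l.length = σ (l ++ [a]) := by
  have := map_range_getD (l ++ [a]) t
  rw [List.length_append, List.length_singleton] at this
  rw [outcome, this]

/-- The moves of I after the position `l` that produce a block sequence of answers of II. -/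
noncomputable def probe (e : Module.Basis ℕ 𝕜 E) (σ : List ℕ → E) (l : List ℕ) : ℕ → ℕ
  | 0 => 0
  | j + 1 => hi e (σ (l ++ [probe e σ l j]))

/-- `s` lists the answers of II by `σ` to the moves `l`, each of which is one of the probes. -/
inductive Answers (e : Module.Basis ℕ 𝕜 E) (σ : List ℕ → E) : List ℕ → List E → Prop
  | nil : Answers e σ [] []
  | snoc {l : List ℕ} {s : List E} (h : Answers e σ l s) (j : ℕ) :
      Answers e σ (l ++ [probe e σ l j]) (s ++ [σ (l ++ [probe e σ l j])])

theorem Answers.exists_of_append {σ : List ℕ → E} {l : List ℕ} {s : List E} {z : E}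
    (h : Answers e σ l (s ++ [z])) : ∃ l' j, Answers e σ l' s ∧ l = l' ++ [probe e σ l' j] ∧
      z = σ (l' ++ [probe e σ l' j]) := by
  generalize ht : s ++ [z] = t at h
  cases h with
  | nil => simp at ht
  | @snoc l' s' h j =>
    obtain ⟨rfl, h2⟩ := List.append_inj' ht rfl
    exact ⟨l', j, h, rfl, by simpa using h2⟩

theorem exists_blockTree_of_iiHasStrategy {S : Set (ℕ → E)} (h : IIHasStrategy e S) :
    ∃ T : Set (List E), IsBlockTree e T ∧ branches e T ⊆ S := by
  obtain ⟨σ, hσ⟩ := h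
  have hn : ∀ l a, ‖σ (l ++ [a])‖ = 1 := fun l a => by
    have := ((hσ fun i => (l ++ [a] ++ []).getD i 0).1 l.length).1
    rwa [outcome_getD] at this
  have hlt : ∀ l a, NatLT e a (σ (l ++ [a])) := fun l a => by
    have := ((hσ fun i => (l ++ [a] ++ []).getD i 0).1 l.length).2.1
    rw [outcome_getD] at this
    simpa using this
  have hv : ∀ l a b, VecLT e (σ (l ++ [a])) (σ (l ++ [a] ++ [b])) := fun l a b => by
    have h1 := ((hσ fun i => (l ++ [a] ++ [b]).getD i 0).1 l.length).2.2
    have h2 := outcome_getD σ (l ++ [a]) [] b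
    rw [outcome_getD] at h1
    rw [List.append_nil, List.length_append, List.length_singleton] at h2
    rwa [h2] at h1
  have hbb : ∀ l, (fun j => σ (l ++ [probe e σ l j])) ∈ bb e := fun l =>
    ⟨fun j => hn _ _, fun j => VecLT.of_natLT (hlt l (probe e σ l (j + 1)))⟩
  -- Distinct probes get distinct answers, so a node remembers I's moves. Hence its successors come
  -- from one position only, and a branch comes from one run.
  have huniq : ∀ s l l', Answers e σ l s → Answers e σ l' s → l = l' := by
    intro s
    induction s using List.reverseRecOn with
    | nil =>
      intro l l' h h'
      have : ∀ l, Answers e σ l [] → l = [] := by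
        intro l h
        generalize ht : ([] : List E) = t at h
        cases h with
        | nil => rfl
        | snoc => simp at ht
      rw [this l h, this l' h']
    | append_singleton s z ih =>
      intro l l' h h'
      obtain ⟨l₁, j, h₁, rfl, hz⟩ := h.exists_of_append
      obtain ⟨l₂, j', h₂, rfl, hz'⟩ := h'.exists_of_append
      obtain rfl := ih _ _ h₁ h₂
      rw [injective_of_mem_bb (hbb l₁) (hz.symm.trans hz')]
  have hlast : ∀ l s, Answers e σ l s → ∀ x ∈ s.getLast?, ∀ a, VecLT e x (σ (l ++ [a])) := by
    intro l s h x hx a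
    cases h with
    | nil => simp at hx
    | snoc h j =>
      rw [List.getLast?_append, List.getLast?_singleton, Option.some_or, Option.mem_some_iff] at hx
      exact hx ▸ hv _ _ _
  refine ⟨{s | ∃ l, Answers e σ l s}, ⟨⟨[], [], .nil⟩, ?_, ?_, ?_⟩, ?_⟩
  · rintro s ⟨l, h⟩
    induction h with
    | nil => exact ⟨by simp, .nil⟩
    | @snoc l s h j ih =>
      refine ⟨fun x hx => ?_, List.isChain_append.2 ⟨ih.2, .singleton _, ?_⟩⟩
      · rcases List.mem_append.1 hx with hx | hx
        · exact ih.1 x hx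
        · rw [List.mem_singleton.1 hx]
          exact hn _ _
      · intro x hx y hy
        rw [List.head?_singleton, Option.mem_some_iff] at hy
        exact hy ▸ hlast l s h x hx _
  · rintro s ⟨l, h⟩
    induction h with
    | nil =>
      intro t ht
      rw [List.prefix_nil.1 ht]
      exact ⟨[], .nil⟩
    | @snoc l s h j ih =>
      intro t ht
      rcases List.prefix_concat_iff.1 ht with rfl | ht
      · exact ⟨_, h.snoc j⟩
      · exact ih t ht
  · rintro s ⟨l, h⟩
    refine ⟨_, hbb l, ?_, fun x hx => hlast l s h x hx _⟩
    ext z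
    constructor
    · rintro ⟨l', h'⟩
      obtain ⟨l₁, j, h₁, _, rfl⟩ := h'.exists_of_append
      obtain rfl := huniq s _ _ h h₁
      exact ⟨j, rfl⟩
    · rintro ⟨j, rfl⟩
      exact ⟨_, h.snoc j⟩
  · rintro x ⟨-, hx⟩
    have hstep : ∀ k l, Answers e σ l ((List.range k).map x) → ∃ a,
        Answers e σ (l ++ [a]) ((List.range (k + 1)).map x) ∧ x k = σ (l ++ [a]) := by
      intro k l h
      obtain ⟨l', h'⟩ := hx k
      rw [map_range_succ] at h'
      obtain ⟨l₁, j, h₁, rfl, hz⟩ := h'.exists_of_append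
      obtain rfl := huniq _ _ _ h h₁
      refine ⟨_, ?_, hz⟩
      rw [map_range_succ, hz]
      exact h.snoc j
    choose! a ha hax using hstep
    -- The run of I recovered from the branch.
    let H : ℕ → List ℕ := Nat.rec [] fun k l => l ++ [a k l]
    have hH : ∀ k, Answers e σ (H k) ((List.range k).map x) := by
      intro k
      induction k with
      | zero => exact .nil
      | succ k ih => exact ha k _ ih
    have hHm : ∀ k, H k = (List.range k).map fun k => a k (H k) := by
      intro k
      induction k with
      | zero => rfl
      | succ k ih => rw [map_range_succ, ← ih]
    have hxo : x = outcome σ fun k => a k (H k) := by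
      funext k
      rw [outcome, ← hHm]
      exact hax k _ (hH k)
    rw [hxo]
    exact (hσ _).2

/-! ### From (c) to (a). -/

theorem IsBlockTree.exists_separates {T : Set (List E)} (hT : IsBlockTree e T) {m : ℕ → ℕ}
    (hm : StrictMono m) : ∃ x ∈ branches e T, Separates e m x := by
  have hnil : [] ∈ T := by
    obtain ⟨s, hs⟩ := hT.nonempty
    exact hT.prefix_mem s hs [] (List.nil_prefix)
  -- The sum dominates `hi` of the last term. The extra `1` leaves room for both `m j` and `m (j +
  -- 1)` in the gap, with `j` equal to that `hi`.
  have hstep : ∀ s : T, ∃ z, s.1 ++ [z] ∈ T ∧ NatLT e (m ((s.1.map (hi e)).sum + 1)) z := by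
    rintro ⟨s, hs⟩
    obtain ⟨y, hy, hys, _⟩ := hT.successors s hs
    refine ⟨y _, ?_, natLT_of_mem_bb hy _⟩
    have : y (m ((s.map (hi e)).sum + 1) + 1) ∈ Set.range y := ⟨_, rfl⟩
    rwa [← hys] at this
  choose z hzT hz using hstep
  let P : ℕ → T := Nat.rec ⟨[], hnil⟩ fun _ s => ⟨s.1 ++ [z s], hzT s⟩
  have hP : ∀ k, (P (k + 1)).1 = (P k).1 ++ [z (P k)] := fun _ => rfl
  have hPx : ∀ k, (P k).1 = (List.range k).map fun i => z (P i) := by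
    intro k
    induction k with
    | zero => rfl
    | succ k ih => rw [map_range_succ, ← ih, hP]
  have hlt : ∀ k, NatLT e (m (hi e (z (P k)) + 1)) (z (P (k + 1))) := by
    intro k i hi'
    refine lt_of_le_of_lt (hm.monotone ?_) (hz (P (k + 1)) i hi')
    rw [hP]
    simp
  have hnorm : ∀ k, ‖z (P k)‖ = 1 := fun k =>
    (hT.subset_fbb (hzT (P k))).1 _ (by simp)
  refine ⟨fun k => z (P k), ⟨⟨hnorm, fun k => ?_⟩, fun n => ?_⟩, fun i => ⟨hi e (z (P i)), ?_, ?_,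
    hm (Nat.lt_succ_self _), hlt i⟩⟩
  · refine VecLT.of_natLT fun j hj => lt_of_le_of_lt ?_ (hlt k j hj)
    exact (Nat.le_succ _).trans hm.le_apply
  · rw [← hPx]
    exact (P (n + 1)).2
  · exact fun j hj => (hm.monotone (Nat.zero_le _)).trans_lt (hz (P i) j hj)
  · exact ltNat_iff.2 hm.le_apply

end AsymptoticGame

theorem mainTheorem4 {𝕜 E : Type*} [RCLike 𝕜] [NormedAddCommGroup E] [NormedSpace 𝕜 E]
    (e : Module.Basis ℕ 𝕜 E) (he : ∀ i, ‖e i‖ = 1)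
    (A : Set (ℕ → E)) (hAbb : A ⊆ AsymptoticGame.bb e) (hA : MeasureTheory.AnalyticSet A) :
    List.TFAE
      [∀ δ : ℕ → ℝ, AsymptoticGame.PosNull δ → ∀ m : ℕ → ℕ, StrictMono m →
          ∃ x : ℕ → E, AsymptoticGame.Separates e m x ∧ x ∈ AsymptoticGame.expansion e A δ,
        ∀ δ : ℕ → ℝ, AsymptoticGame.PosNull δ →
          AsymptoticGame.IIHasStrategy e (AsymptoticGame.expansion e A δ),
        ∀ δ : ℕ → ℝ, AsymptoticGame.PosNull δ →
          ∃ T : Set (List E), AsymptoticGame.IsBlockTree e T ∧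
            AsymptoticGame.branches e T ⊆ AsymptoticGame.expansion e A δ] := by
  tfae_have 1 → 2 := fun h _ hδ => AsymptoticGame.iiHasStrategy_of_forall_separates hA h hδ
  tfae_have 2 → 3 := fun h δ hδ => AsymptoticGame.exists_blockTree_of_iiHasStrategy (h δ hδ)
  tfae_have 3 → 1 := fun h δ hδ m hm => by
    obtain ⟨T, hT, hTA⟩ := h δ hδ
    obtain ⟨x, hx, hxm⟩ := hT.exists_separates hm
    exact ⟨x, hxm, hTA hx⟩
  tfae_finish
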